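/- For a finite graph $G$ and a family $\mathcal H$ of subgraphs of $G$, an edge-colouring of $G$ is called $\mathcal H$-polychromatic if every member of $\mathcal H$ has, among its edges, edges of all the colours present in $G$; let $\mathrm{poly}_{\mathcal H}(G)$ be the largest number of colours in an $\mathcal H$-polychromatic edge-colouring of $G$. Let $F_2$ be the family of all $2$-factors (spanning $2$-regular subgraphs) of the complete graph $K_n$ and $HC$ the family of all Hamiltonian cycles of $K_n$. Then there is an absolute constant $c\le 4$ such that for every integer $n\ge 3$ $$\lfloor \log_2 2(n+1)\rfloor \;\le\; \mathrm{poly}_{F_2}(K_n)\;\le\; \mathrm{poly}_{HC}(K_n)\;\le\; \lfloor \log_2 n\rfloor + c .$$ Moreover, $\left\lfloor \log_2 \frac{8(n-1)}{3}\right\rfloor \le \mathrm{poly}_{HC}(K_n)$ for every $n\ge 3$. -/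

import Mathlib

namespace Polychromatic

variable {V : Type*}

/-- The edge-coloring `φ` of `G` is `𝓗`-polychromatic: every subgraph in the family `𝓗` contains,
for every color that is present in `G`, an edge of that color. -/
def IsPolychromatic {C : Type*} (G : SimpleGraph V) (𝓗 : Set G.Subgraph) (φ : G.edgeSet → C) :
    Prop :=
  ∀ H ∈ 𝓗, ∀ c ∈ Set.range φ, ∃ e : G.edgeSet, (e : Sym2 V) ∈ H.edgeSet ∧ φ e = c

/-- The set of all `k` such that `G` has an `𝓗`-polychromatic edge-coloring
with exactly `k` colors. -/
def colorCounts (G : SimpleGraph V) (𝓗 : Set G.Subgraph) : Set ℕ :=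
  {k | ∃ φ : G.edgeSet → Fin k, Function.Surjective φ ∧ IsPolychromatic G 𝓗 φ}

/-- The `𝓗`-polychromatic number of a (finite) graph `G`: the largest number of colors in an
`𝓗`-polychromatic edge-coloring of `G`. The helper `isGreatest_poly` shows that the maximum is
attained as soon as no member of `𝓗` is without edges. -/
noncomputable def poly (G : SimpleGraph V) (𝓗 : Set G.Subgraph) : ℕ :=
  sSup (colorCounts G 𝓗)

/-- The family of all `2`-factors of `G`: the spanning `2`-regular subgraphs. -/
def twoFactors (G : SimpleGraph V) : Set G.Subgraph :=
  {H | H.IsSpanning ∧ ∀ v : V, (H.neighborSet v).ncard = 2}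

/-- The family of all Hamiltonian cycles of `G`, as subgraphs. -/
def hamiltonianCycles [DecidableEq V] (G : SimpleGraph V) : Set G.Subgraph :=
  {H | ∃ (a : V) (p : G.Walk a a), p.IsHamiltonianCycle ∧ p.toSubgraph = H}

/-- In a finite graph the polychromatic number is a genuine maximum. -/
theorem isGreatest_poly [Finite V] (G : SimpleGraph V) (𝓗 : Set G.Subgraph)
    (h𝓗 : ∀ H ∈ 𝓗, H.edgeSet.Nonempty) : IsGreatest (colorCounts G 𝓗) (poly G 𝓗) := by
  have hb : BddAbove (colorCounts G 𝓗) := by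
    refine ⟨Nat.card G.edgeSet, ?_⟩
    rintro k ⟨φ, hφ, -⟩
    simpa using Nat.card_le_card_of_surjective φ hφ
  have hne : (colorCounts G 𝓗).Nonempty := by
    rcases isEmpty_or_nonempty G.edgeSet with h | ⟨⟨e⟩⟩
    · refine ⟨0, fun e => h.elim e, fun c => c.elim0, ?_⟩
      rintro H - c -
      exact c.elim0
    · refine ⟨1, fun _ => 0, fun c => ⟨e, Subsingleton.elim _ _⟩, ?_⟩
      intro H hH c _
      obtain ⟨f, hf⟩ := h𝓗 H hH
      exact ⟨⟨f, H.edgeSet_subset hf⟩, hf, Subsingleton.elim _ _⟩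
  exact ⟨Nat.sSup_mem hne hb, fun k hk => le_csSup hb hk⟩

/-- The polychromatic number of the complete graph on `n` vertices for its `2`-factors. -/
noncomputable def polyF2 (n : ℕ) : ℕ :=
  poly (⊤ : SimpleGraph (Fin n)) (twoFactors ⊤)

/-- The polychromatic number of the complete graph on `n` vertices for its Hamiltonian cycles. -/
noncomputable def polyHC (n : ℕ) : ℕ :=
  poly (⊤ : SimpleGraph (Fin n)) (hamiltonianCycles ⊤)

end Polychromatic

/-! ### Hamiltonicity and Pósa's degree condition -/

namespace SimpleGraph

variable {V : Type*} {G : SimpleGraph V}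

namespace Walk

/-! Upper bound: in a polychromatic colouring, no colour `t` can be avoided by a Hamiltonian cycle,
so Pósa's condition (`exists_low_degree_of_not_isHamiltonian`) gives a set of `h t` vertices, each
on at most `h t` edges of colours other than `t`. After at most two colours are dropped these sets
are disjoint. Double counting the edges between them (`sum_min_offDiag_le`) bounds the pairwise
minima of their sizes, which forces the total size to double with each further colour
(`two_pow_card_le_of_sum_min_le`). As the total is at most `n`, this gives `2 ^ k ≤ 16 * n`, hence
`c = 4`.

Lower bounds: order the vertices, cut them into blocks of roughly doubling size, and colour an edge
by the block of its smaller end. A 2-factor missing a block's colour sends every edge at the block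
to earlier vertices, so by 2-regularity the block is no larger than what precedes it. For a
Hamiltonian cycle even equal sizes are impossible, by connectedness; this permits smaller blocks. -/

theorem IsPath.isCycle_cons {u v : V} {p : G.Walk v u} (hp : p.IsPath) (h : G.Adj u v)
    (hl : 2 ≤ p.length) : (cons h p).IsCycle := by
  refine (cons_isCycle_iff p h).2 ⟨hp, fun he => ?_⟩
  have := hp.length_eq_one_of_mem_edges (Sym2.eq_swap ▸ he)
  omega

theorem IsHamiltonian.isHamiltonian_of_adj [Fintype V] [DecidableEq V] {u v : V}
    {p : G.Walk v u} (hp : p.IsHamiltonian) (h : G.Adj u v) (hV : 3 ≤ Fintype.card V) :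
    G.IsHamiltonian := by
  intro _
  have hl := hp.length_eq
  refine ⟨u, cons h p, isHamiltonianCycle_iff_isCycle_and_length_eq.2
    ⟨hp.isPath.isCycle_cons h (by omega), ?_⟩⟩
  rw [length_cons]
  omega

/-- Pósa rotation: follow `p` from position `i + 1` to `v`, jump to position `i`, and return along
`p` to `u`; the edge at `u` closes the cycle. -/
theorem IsHamiltonian.isHamiltonian_of_crossing [Fintype V] [DecidableEq V] {u v : V}
    {p : G.Walk u v} (hp : p.IsHamiltonian) (hV : 3 ≤ Fintype.card V) {i : ℕ}
    (hi : i < p.length) (hu : G.Adj u (p.getVert (i + 1))) (hv : G.Adj v (p.getVert i)) :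
    G.IsHamiltonian := by
  let q : G.Walk (p.getVert (i + 1)) u := (p.drop (i + 1)).append (cons hv (p.take i).reverse)
  have hq : q.support.Perm p.support := by
    have h1 : q.support = p.support.drop (i + 1) ++ (p.support.take (i + 1)).reverse := by
      simp only [q, support_append, support_cons, support_reverse, List.tail_cons, support_take]
      rw [drop_support_eq_support_drop_min]
      congr 2
      omega
    rw [h1]
    refine ((List.reverse_perm _).append_left _).trans (List.perm_append_comm.trans ?_)
    rw [List.take_append_drop]
  have hqH : q.IsHamiltonian := fun a => by rw [hq.count_eq]; exact hp a
  exact hqH.isHamiltonian_of_adj hu hV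

end Walk

variable [Fintype V] [DecidableEq V]

theorem isHamiltonian_top (hV : 3 ≤ Fintype.card V) : (⊤ : SimpleGraph V).IsHamiltonian := by
  have : Nonempty V := Fintype.card_pos_iff.1 (by omega)
  obtain ⟨u, v, p, hp, hmax⟩ :=
    Walk.exists_isPath_forall_isPath_length_le_length (⊤ : SimpleGraph V)
  have hH : p.IsHamiltonian := hp.isHamiltonian_of_mem fun w => by
    by_contra hw
    have hne : w ≠ u := fun h => hw (h ▸ p.start_mem_support)
    have := hmax _ _ (Walk.cons (show (⊤ : SimpleGraph V).Adj w u from hne) p) (hp.cons hw)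
    simp at this
  have hl := hH.length_eq
  refine hH.isHamiltonian_of_adj (show v ≠ u from ?_) hV
  rintro rfl
  have := Walk.length_eq_zero_iff.2 (Walk.isPath_iff_nil.1 hp)
  omega

theorem exists_isHamiltonian_walk_of_sup_edge {u v : V} (huv : u ≠ v)
    (hV : 3 ≤ Fintype.card V) (hG : ¬ G.IsHamiltonian) (h : (G ⊔ edge u v).IsHamiltonian) :
    ∃ p : G.Walk u v, p.IsHamiltonian := by
  have hnt : Nontrivial V := ⟨u, v, huv⟩
  obtain ⟨c, hc⟩ := h.exists_isHamiltonianCycle v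
  have hmem : s(v, u) ∈ c.edges := by
    by_contra hmem
    refine hG fun _ => ⟨v, c.transfer G ?_, ?_⟩
    · intro e he
      have := c.edges_subset_edgeSet he
      rw [edgeSet_sup, Set.mem_union] at this
      refine this.resolve_right fun h' => hmem ?_
      rw [edgeSet_edge_of_ne huv] at h'
      rw [Sym2.eq_swap, ← Set.mem_singleton_iff.1 h']
      exact he
    · rw [Walk.isHamiltonianCycle_iff_isCycle_and_length_eq] at hc ⊢
      exact ⟨hc.1.transfer _, by rw [Walk.length_transfer]; exact hc.2⟩
  have key : ∀ c : (G ⊔ edge u v).Walk v v, c.IsHamiltonianCycle → c.snd = u →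
      ∃ p : G.Walk u v, p.IsHamiltonian := by
    intro c hc hs
    cases c with
    | nil => exact absurd hc.isCycle (by simp)
    | cons hadj q =>
      simp only [Walk.snd_cons] at hs
      subst hs
      have hcyc := hc.isCycle
      rw [Walk.cons_isCycle_iff] at hcyc
      have hl := hc.length_eq
      rw [Walk.length_cons] at hl
      refine ⟨q.transfer G ?_, ?_⟩
      · intro e he
        have := q.edges_subset_edgeSet he
        rw [edgeSet_sup, Set.mem_union] at this
        refine this.resolve_right fun h' => hcyc.2 ?_
        rw [edgeSet_edge_of_ne huv] at h'
        rw [Sym2.eq_swap, ← Set.mem_singleton_iff.1 h']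
        exact he
      · rw [Walk.isHamiltonian_iff_isPath_and_length_eq]
        exact ⟨hcyc.1.transfer _, by rw [Walk.length_transfer]; omega⟩
  have hu : u ∈ c.toSubgraph.neighborSet v := by
    rw [Subgraph.mem_neighborSet, ← Subgraph.mem_edgeSet, Walk.mem_edges_toSubgraph]
    exact hmem
  rw [hc.isCycle.neighborSet_toSubgraph_endpoint] at hu
  rcases hu with hu | hu
  · exact key c hc hu.symm
  · refine key c.reverse ?_ ?_
    · rw [Walk.isHamiltonianCycle_iff_isCycle_and_length_eq] at hc ⊢
      exact ⟨hc.1.reverse, by rw [Walk.length_reverse]; exact hc.2⟩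
    · rw [Walk.snd_reverse]; exact hu.symm

/-- Pósa's condition: a non-Hamiltonian graph on `n ≥ 3` vertices has, for some `h` with
`1 ≤ h ≤ (n - 1) / 2`, at least `h` vertices of degree at most `h`,
and even `h + 1` of them if `h = (n - 1) / 2`. -/
theorem exists_low_degree_of_not_isHamiltonian (hV : 3 ≤ Fintype.card V)
    (hG : ¬ G.IsHamiltonian) :
    ∃ (h : ℕ) (S : Finset V), 1 ≤ h ∧ (∀ v ∈ S, (G.neighborSet v).ncard ≤ h) ∧
      (2 * h + 1 < Fintype.card V ∧ S.card = h ∨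
        2 * h + 1 = Fintype.card V ∧ S.card = h + 1) := by
  classical
  -- Adding edges only raises degrees, so low degrees in an edge-maximal non-Hamiltonian `M` are
  -- inherited by `G`.
  obtain ⟨M, hGM, hM⟩ := Finite.exists_le_maximal (p := fun M : SimpleGraph V => ¬ M.IsHamiltonian) hG
  have hmono : ∀ v, (G.neighborSet v).ncard ≤ (M.neighborSet v).ncard := fun v =>
    Set.ncard_le_ncard (fun w hw => hGM hw) (Set.toFinite _)
  set d : V → ℕ := fun v => (M.neighborSet v).ncard with hd
  have hne : (Finset.univ.filter fun x : V × V => x.1 ≠ x.2 ∧ ¬ M.Adj x.1 x.2 ∧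
      d x.1 ≤ d x.2).Nonempty := by
    by_contra hemp
    have : M = ⊤ := by
      ext a b
      simp only [top_adj]
      refine ⟨fun h => h.ne, fun hab => ?_⟩
      by_contra hadj
      apply hemp
      rcases le_total (d a) (d b) with h | h
      · exact ⟨(a, b), by simp [hab, hadj, h]⟩
      · exact ⟨(b, a), by simp [hab.symm, adj_comm, hadj, h]⟩
    exact hM.prop (this ▸ isHamiltonian_top hV)
  obtain ⟨⟨u, v⟩, huv, hmax⟩ := Finset.exists_max_image _ (fun x : V × V => d x.1 + d x.2) hne
  simp only [Finset.mem_filter, Finset.mem_univ, true_and, Prod.forall] at huv hmax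
  obtain ⟨huv, hadj, hle⟩ := huv
  have hmax' : ∀ w, w ≠ v → ¬ M.Adj v w → d w ≤ d u := by
    intro w hw hwv
    have h1 : ¬ M.Adj w v := fun h => hwv h.symm
    rcases le_total (d w) (d v) with h | h
    · have := hmax w v ⟨hw, h1, h⟩; omega
    · have := hmax v w ⟨hw.symm, hwv, h⟩; omega
  obtain ⟨p, hp⟩ : ∃ p : M.Walk u v, p.IsHamiltonian := by
    refine exists_isHamiltonian_walk_of_sup_edge huv hV hM.prop ?_
    by_contra hcon
    have := hM.le_of_ge hcon le_sup_left
    exact hadj (this (Or.inr (by simp [edge_adj, huv])))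
  have hl := hp.length_eq
  have hinj : ∀ i j, i ≤ p.length → j ≤ p.length → p.getVert i = p.getVert j → i = j :=
    fun i j hi hj h => hp.isPath.getVert_injOn hi hj h
  let J := (Finset.range p.length).filter fun i => M.Adj u (p.getVert (i + 1))
  -- Path predecessors of the neighbours of `u`. By rotation none is adjacent to `v`, so the maximal
  -- degree sum of `u, v` bounds their degrees by `d u`.
  let S := J.image p.getVert
  have hS : S.card = J.card := Finset.card_image_of_injOn fun i hi j hj h => by
    simp only [J, Finset.coe_filter, Finset.mem_range, Set.mem_ofPred_eq] at hi hj
    exact hinj i j hi.1.le hj.1.le h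
  have hJ : J.card = d u := by
    have : M.neighborSet u = ↑(J.image fun i => p.getVert (i + 1)) := by
      ext w
      simp only [mem_neighborSet, Finset.coe_image, Set.mem_image, J, Finset.coe_filter,
        Finset.mem_range, Set.mem_ofPred_eq]
      constructor
      · intro hw
        obtain ⟨i, hi, hil⟩ := Walk.mem_support_iff_exists_getVert.1 (hp.mem_support w)
        cases i with
        | zero => rw [Walk.getVert_zero] at hi; exact absurd hi hw.ne
        | succ i => exact ⟨i, ⟨by omega, hi ▸ hw⟩, hi⟩
      · rintro ⟨i, hi, rfl⟩
        exact hi.2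
    simp only [hd]
    rw [this, Set.ncard_coe_finset, Finset.card_image_of_injOn]
    intro i hi j hj h
    simp only [J, Finset.coe_filter, Finset.mem_range, Set.mem_ofPred_eq] at hi hj
    have := hinj (i + 1) (j + 1) (by omega) (by omega) h
    omega
  have hvS : v ∉ S := by
    simp only [S, Finset.mem_image, J, Finset.mem_filter, Finset.mem_range]
    rintro ⟨i, ⟨hi, -⟩, h⟩
    have := hinj i p.length hi.le le_rfl (by rw [h, Walk.getVert_length])
    omega
  have hSv : ∀ w ∈ S, ¬ M.Adj v w := by
    simp only [S, Finset.mem_image, J, Finset.mem_filter, Finset.mem_range]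
    rintro w ⟨i, ⟨hi, hi'⟩, rfl⟩ h
    exact hM.prop (hp.isHamiltonian_of_crossing hV hi hi' h)
  have hSd : ∀ w ∈ S, d w ≤ d u := fun w hw => hmax' w (fun h => hvS (h ▸ hw)) (hSv w hw)
  have hsum : d u + d v + 1 ≤ Fintype.card V := by
    have hdis : Disjoint (insert v S) (M.neighborFinset v) := by
      rw [Finset.disjoint_left]
      intro w hw hw'
      rw [mem_neighborFinset] at hw'
      rcases Finset.mem_insert.1 hw with rfl | hw
      · exact hw'.ne rfl
      · exact hSv w hw hw'
    have := Finset.card_le_univ ((insert v S) ∪ M.neighborFinset v)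
    rw [Finset.card_union_of_disjoint hdis, Finset.card_insert_of_notMem hvS, hS, hJ,
      ← Set.ncard_coe_finset (M.neighborFinset v), coe_neighborFinset] at this
    simp only [hd] at this ⊢
    omega
  have hu1 : 1 ≤ d u := by
    rw [← hJ, Nat.one_le_iff_ne_zero, Finset.card_ne_zero]
    refine ⟨0, ?_⟩
    simp only [J, Finset.mem_filter, Finset.mem_range]
    refine ⟨by omega, ?_⟩
    simpa using p.adj_getVert_succ (i := 0) (by omega)
  -- In the extremal case `d u + d v < n` forces `d v ≤ d u`, so `v` itself supplies the additional
  -- vertex.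
  by_cases heq : 2 * d u + 1 = Fintype.card V
  · refine ⟨d u, insert v S, hu1, ?_, Or.inr ⟨heq, by rw [Finset.card_insert_of_notMem hvS, hS, hJ]⟩⟩
    intro w hw
    refine (hmono w).trans ?_
    rcases Finset.mem_insert.1 hw with rfl | hw
    · change d w ≤ d u
      omega
    · exact hSd w hw
  · exact ⟨d u, S, hu1, fun w hw => (hmono w).trans (hSd w hw),
      Or.inl ⟨by omega, by rw [hS, hJ]⟩⟩

end SimpleGraph

/-! ### Exponential growth from pairwise minima -/

namespace Finset

variable {ι : Type*} [DecidableEq ι]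

theorem sum_min_offDiag_insert {x : ι → ℕ} {T : Finset ι} {s : ι} (hs : s ∉ T)
    (hx : ∀ t ∈ T, x t ≤ x s) :
    ∑ p ∈ (insert s T).offDiag, min (x p.1) (x p.2) =
      ∑ p ∈ T.offDiag, min (x p.1) (x p.2) + 2 * ∑ t ∈ T, x t := by
  have h1 : ∑ p ∈ (insert s T).offDiag, min (x p.1) (x p.2) =
      ∑ a ∈ insert s T, ∑ b ∈ (insert s T).erase a, min (x a) (x b) :=
    sum_finset_product _ _ _ (by simp [mem_offDiag, mem_erase]; tauto)
  have h2 : ∑ p ∈ T.offDiag, min (x p.1) (x p.2) =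
      ∑ a ∈ T, ∑ b ∈ T.erase a, min (x a) (x b) :=
    sum_finset_product _ _ _ (by simp [mem_offDiag, mem_erase]; tauto)
  have h3 : ∀ a ∈ T, ∑ b ∈ (insert s T).erase a, min (x a) (x b) =
      x a + ∑ b ∈ T.erase a, min (x a) (x b) := by
    intro a ha
    have : a ≠ s := fun h => hs (h ▸ ha)
    rw [erase_insert_of_ne this.symm, sum_insert (fun h => hs (mem_of_mem_erase h)),
      min_eq_left (hx a ha)]
  rw [h1, h2, sum_insert hs, erase_insert hs, sum_congr rfl h3, sum_add_distrib,
    sum_congr rfl fun b hb => min_eq_right (hx b hb)]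
  ring

/-- If the pairwise minima of positive integers sum to at most the sum of the integers, for every
subfamily, then the sum is exponentially large in the size of the family. -/
theorem two_pow_card_le_of_sum_min_le {x : ι → ℕ} {T : Finset ι} (hT : T.Nonempty)
    (hpos : ∀ t ∈ T, 1 ≤ x t)
    (h : ∀ U ⊆ T, ∑ p ∈ U.offDiag, min (x p.1) (x p.2) ≤ 2 * ∑ t ∈ U, x t) :
    2 ^ T.card ≤ 4 * ∑ t ∈ T, x t := by
  have key : ∀ U : Finset ι, U ⊆ T → 2 ≤ U.card →
      2 ^ U.card ≤ 2 * ∑ p ∈ U.offDiag, min (x p.1) (x p.2) := by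
    intro U
    induction U using Finset.induction_on_max_value x with
    | empty => simp
    | insert s U hs hmax ih =>
      intro hU hcard
      have hU' : U ⊆ T := (subset_insert s U).trans hU
      -- Adding a largest element increases the sum of minima by twice the old total, which by `h`
      -- is at least the old sum of minima: it doubles.
      rw [sum_min_offDiag_insert hs hmax]
      rw [card_insert_of_notMem hs] at hcard ⊢
      rcases Nat.lt_or_ge U.card 2 with h2 | h2
      · obtain ⟨a, rfl⟩ := card_eq_one.1 (show U.card = 1 by omega)
        have := hpos a (hU' (mem_singleton_self a))
        simp
        omega
      · have := ih hU' h2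
        have := h U hU'
        rw [pow_succ]
        omega
  rcases Nat.lt_or_ge T.card 2 with h2 | h2
  · obtain ⟨a, rfl⟩ := card_eq_one.1 (show T.card = 1 by have := hT.card_pos; omega)
    have := hpos a (mem_singleton_self a)
    simp
    omega
  · have := key T Subset.rfl h2
    have := h T Subset.rfl
    omega

end Finset

/-! ### Upper bound: low-degree sets of the colours -/

namespace Polychromatic

open Finset

variable {V C : Type*}

/-- The graph of all pairs of distinct vertices whose color is not `t`. -/
def avoid (col : Sym2 V → C) (t : C) : SimpleGraph V where
  Adj u v := u ≠ v ∧ col s(u, v) ≠ t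
  symm := ⟨fun u v h => ⟨h.1.symm, Sym2.eq_swap (a := u) (b := v) ▸ h.2⟩⟩
  loopless := ⟨fun _ h => h.1 rfl⟩

variable [Fintype V]

theorem card_sub_one_le_ncard_add_ncard (col : Sym2 V → C) {s t : C} (hst : s ≠ t) (v : V) :
    Fintype.card V - 1 ≤
      ((avoid col s).neighborSet v).ncard + ((avoid col t).neighborSet v).ncard := by
  refine le_trans ?_ (Set.ncard_union_le _ _)
  rw [← Nat.card_eq_fintype_card, ← Set.ncard_univ, ← Set.ncard_sdiff_singleton_of_mem (Set.mem_univ v)]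
  refine Set.ncard_le_ncard ?_ (Set.toFinite _)
  intro w hw
  have hvw : v ≠ w := fun h => hw.2 h.symm
  by_cases h : col s(v, w) = s
  · exact Or.inr ⟨hvw, fun h' => hst (h.symm.trans h')⟩
  · exact Or.inl ⟨hvw, h⟩

/-- Each colour of `E` accounts for at least `(h + 1) * h` ordered pairs of vertices, out of `(2 * h
+ 1) * (2 * h)`; four colours would need too many. -/
theorem card_le_three_of_half_degree (col : Sym2 V → C) {h : ℕ} (h1 : 1 ≤ h)
    (hV : 2 * h + 1 = Fintype.card V) {E : Finset C}
    (hE : ∀ t ∈ E, ∃ S : Finset V, S.card = h + 1 ∧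
      ∀ v ∈ S, ((avoid col t).neighborSet v).ncard ≤ h) : E.card ≤ 3 := by
  classical
  let D : C → V → ℕ := fun t v => ((univ.erase v).filter fun w => col s(v, w) = t).card
  have hlow : ∀ t ∈ E, (h + 1) * h ≤ ∑ v, D t v := by
    intro t ht
    obtain ⟨S, hS, hS'⟩ := hE t ht
    rw [← hS, ← smul_eq_mul]
    refine le_trans (card_nsmul_le_sum S (D t) h fun v hv => ?_)
      (sum_le_sum_of_subset (subset_univ S))
    have h2 : (avoid col t).neighborSet v =
        ↑((univ.erase v).filter fun w => ¬ col s(v, w) = t) := by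
      ext w
      simp [avoid, eq_comm]
    have h3 := hS' v hv
    rw [h2, Set.ncard_coe_finset] at h3
    have h4 := card_filter_add_card_filter_not (s := univ.erase v) (fun w => col s(v, w) = t)
    rw [card_erase_of_mem (mem_univ v), card_univ] at h4
    simp only [D]
    omega
  have hup : ∀ v, ∑ t ∈ E, D t v ≤ 2 * h := by
    intro v
    have h5 : ∑ t ∈ E, D t v ≤ (univ.erase v).card := by
      simp only [D]
      rw [← card_biUnion]
      · exact card_le_card (biUnion_subset.2 fun t _ => filter_subset _ _)
      · intro s _ t _ hst
        rw [Function.onFun, disjoint_left]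
        intro w hw hw'
        rw [mem_filter] at hw hw'
        exact hst (hw.2.symm.trans hw'.2)
    rw [card_erase_of_mem (mem_univ v), card_univ] at h5
    omega
  have h6 : E.card * ((h + 1) * h) ≤ Fintype.card V * (2 * h) := by
    calc E.card * ((h + 1) * h) ≤ ∑ t ∈ E, ∑ v, D t v := by
          rw [← smul_eq_mul]; exact card_nsmul_le_sum _ _ _ hlow
      _ = ∑ v, ∑ t ∈ E, D t v := sum_comm
      _ ≤ _ := by
          rw [← card_univ, ← smul_eq_mul]
          exact sum_le_card_nsmul _ _ _ fun v _ => hup v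
  rw [← hV] at h6
  by_contra hcon
  have h7 : 4 * ((h + 1) * h) ≤ E.card * ((h + 1) * h) := Nat.mul_le_mul_right _ (by omega)
  nlinarith

variable [DecidableEq V] [DecidableEq C]

/-- A pair in `S t ×ˢ S s` avoids colour `t` or colour `s`, and at most `(S t).card ^ 2` pairs
starting in `S t` avoid `t`. Weighting the latter by `1 / (S t).card` works because a product
divided by the maximum is the minimum. -/
theorem sum_min_offDiag_le (col : Sym2 V → C) {S : C → Finset V} {U : Finset C}
    (hne : ∀ t ∈ U, 1 ≤ (S t).card)
    (hS : ∀ t ∈ U, ∀ v ∈ S t, ((avoid col t).neighborSet v).ncard ≤ (S t).card)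
    (hdis : ∀ t ∈ U, ∀ s ∈ U, t ≠ s → Disjoint (S t) (S s)) :
    ∑ p ∈ U.offDiag, min (S p.1).card (S p.2).card ≤ 2 * ∑ t ∈ U, (S t).card := by
  let N : C → C → ℕ := fun t s => ((S t ×ˢ S s).filter fun p => col s(p.1, p.2) ≠ t).card
  have hN : ∀ p ∈ U.offDiag, (S p.1).card * (S p.2).card ≤ N p.1 p.2 + N p.2 p.1 := by
    rintro ⟨t, s⟩ hp
    simp only [mem_offDiag] at hp
    have h1 : N s t = ((S t ×ˢ S s).filter fun p => col s(p.1, p.2) ≠ s).card := by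
      refine card_bij (fun p _ => p.swap) ?_ ?_ ?_
      · rintro ⟨a, b⟩ h
        simp only [mem_filter, mem_product, Prod.swap] at h ⊢
        exact ⟨h.1.symm, Sym2.eq_swap (a := a) (b := b) ▸ h.2⟩
      · intro a _ b _ h
        exact Prod.swap_injective h
      · rintro ⟨a, b⟩ h
        refine ⟨(b, a), ?_, rfl⟩
        simp only [mem_filter, mem_product] at h ⊢
        exact ⟨h.1.symm, Sym2.eq_swap (a := a) (b := b) ▸ h.2⟩
    rw [h1, ← card_product]
    refine le_trans (card_le_card ?_) (card_union_le _ _)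
    intro p hp'
    simp only [mem_union, mem_filter, hp', true_and]
    by_contra hcon
    push Not at hcon
    exact hp.2.2 (hcon.1.symm.trans hcon.2)
  have hrow : ∀ t ∈ U, ∑ s ∈ U.erase t, N t s ≤ (S t).card * (S t).card := by
    intro t ht
    have h1 : ∀ s ∈ U.erase t, N t s =
        ∑ v ∈ S t, ((S s).filter fun w => col s(v, w) ≠ t).card := by
      intro s _
      simp only [N, card_filter, sum_product]
    rw [sum_congr rfl h1, sum_comm, ← smul_eq_mul]
    refine sum_le_card_nsmul _ _ _ fun v hv => ?_
    refine le_trans ?_ (hS t ht v hv)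
    rw [← card_biUnion]
    · rw [← Set.ncard_coe_finset]
      refine Set.ncard_le_ncard ?_ (Set.toFinite _)
      intro w hw
      simp only [coe_biUnion, Set.mem_iUnion, mem_coe, mem_filter, mem_erase] at hw
      obtain ⟨s, ⟨hst, hs⟩, hw, hcol⟩ := hw
      refine ⟨?_, hcol⟩
      rintro rfl
      exact disjoint_left.1 (hdis t ht s hs hst.symm) hv hw
    · intro s hs s' hs' hss
      simp only [mem_coe, mem_erase] at hs hs'
      exact (hdis s hs.2 s' hs'.2 hss).mono (filter_subset _ _) (filter_subset _ _)
  have hQ : (∑ p ∈ U.offDiag, min ((S p.1).card : ℚ) (S p.2).card) ≤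
      2 * ∑ t ∈ U, ((S t).card : ℚ) := by
    have hpos : ∀ t ∈ U, (0 : ℚ) < (S t).card := fun t ht => by exact_mod_cast hne t ht
    calc (∑ p ∈ U.offDiag, min ((S p.1).card : ℚ) (S p.2).card)
        ≤ ∑ p ∈ U.offDiag, ((N p.1 p.2 : ℚ) / (S p.1).card + (N p.2 p.1 : ℚ) / (S p.2).card) := by
          refine sum_le_sum fun p hp => ?_
          have hNp : ((S p.1).card : ℚ) * (S p.2).card ≤ N p.1 p.2 + N p.2 p.1 := by
            exact_mod_cast hN p hp
          rw [mem_offDiag] at hp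
          have h1 := hpos _ hp.1
          have h2 := hpos _ hp.2.1
          have hm : 0 < max ((S p.1).card : ℚ) (S p.2).card := lt_max_of_lt_left h1
          calc min ((S p.1).card : ℚ) (S p.2).card
              = ((S p.1).card : ℚ) * (S p.2).card / max ((S p.1).card : ℚ) (S p.2).card := by
                rw [eq_div_iff hm.ne', min_mul_max]
            _ ≤ (N p.1 p.2 + N p.2 p.1) / max ((S p.1).card : ℚ) (S p.2).card := by gcongr
            _ = N p.1 p.2 / max ((S p.1).card : ℚ) (S p.2).card +
                N p.2 p.1 / max ((S p.1).card : ℚ) (S p.2).card := add_div _ _ _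
            _ ≤ _ := by
                gcongr
                · exact le_max_left _ _
                · exact le_max_right _ _
      _ = 2 * ∑ p ∈ U.offDiag, (N p.1 p.2 : ℚ) / (S p.1).card := by
          rw [sum_add_distrib, two_mul]
          congr 1
          refine sum_bij (fun p _ => p.swap) ?_ ?_ ?_ ?_
          · intro p hp
            simp only [mem_offDiag, Prod.fst_swap, Prod.snd_swap] at hp ⊢
            exact ⟨hp.2.1, hp.1, hp.2.2.symm⟩
          · intro a _ b _ h
            exact Prod.swap_injective h
          · intro p hp
            refine ⟨p.swap, ?_, Prod.swap_swap p⟩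
            simp only [mem_offDiag, Prod.fst_swap, Prod.snd_swap] at hp ⊢
            exact ⟨hp.2.1, hp.1, hp.2.2.symm⟩
          · intro p _
            rfl
      _ = 2 * ∑ t ∈ U, ∑ s ∈ U.erase t, (N t s : ℚ) / (S t).card := by
          congr 1
          exact sum_finset_product _ _ _ (by simp [mem_offDiag, mem_erase]; tauto)
      _ ≤ 2 * ∑ t ∈ U, ((S t).card : ℚ) := by
          refine mul_le_mul_of_nonneg_left (sum_le_sum fun t ht => ?_) (by norm_num)
          rw [← sum_div, div_le_iff₀ (hpos t ht)]
          exact_mod_cast hrow t ht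
  exact_mod_cast hQ

/-- If no color class can be avoided by a Hamiltonian cycle, then the number of colors is at most
logarithmic in the number of vertices. -/
theorem two_pow_card_le_of_not_isHamiltonian [Fintype C] (hV : 3 ≤ Fintype.card V)
    (col : Sym2 V → C) (hcol : ∀ t, ¬ (avoid col t).IsHamiltonian) :
    2 ^ Fintype.card C ≤ 16 * Fintype.card V := by
  choose h S h1 hS hcard using fun t =>
    SimpleGraph.exists_low_degree_of_not_isHamiltonian hV (hcol t)
  choose R hRS hR using fun t => exists_subset_card_eq (s := S t) (n := h t)
    (by rcases hcard t with h | h <;> omega)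
  rcases isEmpty_or_nonempty C with hC | ⟨⟨c₀⟩⟩
  · rw [Fintype.card_eq_zero]
    omega
  let E : Finset C := univ.filter fun t => 2 * h t + 1 = Fintype.card V
  have hE : E.card ≤ 3 := by
    rcases E.eq_empty_or_nonempty with h0 | ⟨e, he⟩
    · simp [h0]
    · rw [mem_filter] at he
      refine card_le_three_of_half_degree col (h1 e) he.2 fun t ht => ⟨S t, ?_⟩
      rw [mem_filter] at ht
      have : h t = h e := by omega
      rw [← this]
      exact ⟨by rcases hcard t with h | h <;> omega, hS t⟩
  -- Disjointness fails only if both colours have `2 * h + 1 = n`, so one of these at most three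
  -- colours may be kept.
  obtain ⟨T, hTne, hT, hTE⟩ : ∃ T : Finset C, T.Nonempty ∧ Fintype.card C ≤ T.card + 2 ∧
      ∀ t ∈ T, ∀ s ∈ T, t ≠ s → h t + h s < Fintype.card V - 1 := by
    have hlt : ∀ t, t ∉ E → 2 * h t + 1 < Fintype.card V := by
      intro t ht
      simp only [E, mem_filter, mem_univ, true_and] at ht
      rcases hcard t with h | h <;> omega
    have hle : ∀ t, 2 * h t + 1 ≤ Fintype.card V := fun t => by
      rcases hcard t with h | h <;> omega
    rcases E.eq_empty_or_nonempty with h0 | ⟨e, he⟩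
    · refine ⟨univ, ⟨c₀, mem_univ _⟩, by rw [card_univ]; omega, fun t _ s _ _ => ?_⟩
      have := hlt t (by simp [h0])
      have := hle s
      omega
    · refine ⟨insert e Eᶜ, insert_nonempty _ _, ?_, fun t ht s hs hts => ?_⟩
      · rw [card_insert_of_notMem (by simpa using he)]
        have := card_add_card_compl E
        omega
      · have h2 := hle t
        have h3 := hle s
        rw [mem_insert, mem_compl] at ht hs
        rcases ht with rfl | ht
        · rcases hs with rfl | hs
          · exact absurd rfl hts
          · have := hlt s hs
            omega
        · have := hlt t ht
          omega
  have hdis : ∀ t ∈ T, ∀ s ∈ T, t ≠ s → Disjoint (R t) (R s) := by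
    intro t ht s hs hts
    rw [disjoint_left]
    intro v hvt hvs
    have := hTE t ht s hs hts
    have := hS t v (hRS t hvt)
    have := hS s v (hRS s hvs)
    have := card_sub_one_le_ncard_add_ncard col hts v
    omega
  have hmain : 2 ^ T.card ≤ 4 * ∑ t ∈ T, (R t).card := by
    refine two_pow_card_le_of_sum_min_le hTne (fun t _ => by rw [hR]; exact h1 t) fun U hU => ?_
    refine sum_min_offDiag_le col (fun t _ => by rw [hR]; exact h1 t)
      (fun t _ v hv => by rw [hR]; exact hS t v (hRS t hv))
      (fun t ht s hs => hdis t (hU ht) s (hU hs))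
  have hsum : ∑ t ∈ T, (R t).card ≤ Fintype.card V := by
    rw [← card_biUnion fun t ht s hs hts => hdis t ht s hs hts]
    exact card_le_univ _
  calc 2 ^ Fintype.card C ≤ 2 ^ (T.card + 2) := Nat.pow_le_pow_right (by norm_num) hT
    _ = 4 * 2 ^ T.card := by ring
    _ ≤ 16 * Fintype.card V := by omega

end Polychromatic

/-! ### Lower bounds: ordered colourings -/

namespace Polychromatic

open Finset SimpleGraph

variable {V : Type*}

theorem exists_adj_boundary [DecidableEq V] {G : SimpleGraph V} {H : G.Subgraph}
    (hH : H ∈ hamiltonianCycles G) (P : Set V) {a b : V} (ha : a ∈ P) (hb : b ∉ P) :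
    ∃ x ∈ P, ∃ y ∉ P, H.Adj x y := by
  obtain ⟨u, p, hp, rfl⟩ := hH
  have hb' : b ∈ (p.rotate a (hp.mem_support a)).support := (hp.rotate _).mem_support b
  obtain ⟨d, hd, h1, h2⟩ := Walk.exists_boundary_dart
    ((p.rotate a (hp.mem_support a)).takeUntil b hb') P ha hb
  refine ⟨d.fst, h1, d.snd, h2, ?_⟩
  rw [← Walk.toSubgraph_rotate p (hp.mem_support a), ← Subgraph.mem_edgeSet,
    Walk.mem_edges_toSubgraph]
  exact Walk.edges_takeUntil_subset_edges _ hb' (List.mem_map_of_mem hd)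

theorem hamiltonianCycles_subset_twoFactors [DecidableEq V] (G : SimpleGraph V) :
    hamiltonianCycles G ⊆ twoFactors G := by
  rintro _ ⟨a, p, hp, rfl⟩
  exact ⟨fun v => p.mem_verts_toSubgraph.2 (hp.mem_support v),
    fun v => hp.isCycle.ncard_neighborSet_toSubgraph_eq_two (hp.mem_support v)⟩

theorem nonempty_hamiltonianCycles_top [Fintype V] [DecidableEq V] (hV : 3 ≤ Fintype.card V) :
    (hamiltonianCycles (⊤ : SimpleGraph V)).Nonempty := by
  obtain ⟨a, p, hp⟩ := isHamiltonian_top hV (by omega)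
  exact ⟨_, a, p, hp, rfl⟩

theorem exists_adj_of_mem_twoFactors {G : SimpleGraph V} {H : G.Subgraph}
    (hH : H ∈ twoFactors G) (v z : V) : ∃ w, w ≠ z ∧ H.Adj v w := by
  by_contra! hcon
  have h1 : H.neighborSet v ⊆ {z} := fun w hw => by
    by_contra hz
    exact hcon w hz hw
  have h2 := Set.ncard_le_ncard h1 (Set.finite_singleton z)
  rw [hH.2 v, Set.ncard_singleton] at h2
  omega

theorem edgeSet_nonempty_of_mem_twoFactors [Nonempty V] {G : SimpleGraph V} {H : G.Subgraph}
    (hH : H ∈ twoFactors G) : H.edgeSet.Nonempty := by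
  obtain ⟨v⟩ := ‹Nonempty V›
  obtain ⟨w, -, hw⟩ := exists_adj_of_mem_twoFactors hH v v
  exact ⟨s(v, w), hw⟩

/-- In a `2`-factor, if all neighbors of `M` lie in `N`, then `M` is at most as large as `N`, and
in case of equality all neighbors of `N` lie in `M`. -/
theorem card_le_card_of_mem_twoFactors [Finite V] {G : SimpleGraph V} {H : G.Subgraph}
    (hH : H ∈ twoFactors G) {M N : Finset V} (hMN : ∀ v ∈ M, ∀ w, H.Adj v w → w ∈ N) :
    M.card ≤ N.card ∧ (M.card = N.card → ∀ w ∈ N, ∀ v, H.Adj w v → v ∈ M) := by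
  classical
  have h1 : ∀ v ∈ M, (N.bipartiteAbove H.Adj v).card = 2 := by
    intro v hv
    rw [← hH.2 v, ← Set.ncard_coe_finset]
    congr 1
    ext w
    simp only [bipartiteAbove, coe_filter, Set.mem_ofPred_eq, Subgraph.mem_neighborSet]
    exact ⟨fun h => h.2, fun h => ⟨hMN v hv w h, h⟩⟩
  have hsub : ∀ w, (↑(M.bipartiteBelow H.Adj w) : Set V) ⊆ H.neighborSet w := by
    intro w v hv
    simp only [bipartiteBelow, coe_filter, Set.mem_ofPred_eq] at hv
    exact hv.2.symm
  have h2 : ∀ w ∈ N, (M.bipartiteBelow H.Adj w).card ≤ 2 := by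
    intro w _
    rw [← hH.2 w, ← Set.ncard_coe_finset]
    exact Set.ncard_le_ncard (hsub w) (Set.toFinite _)
  have h3 := sum_card_bipartiteAbove_eq_sum_card_bipartiteBelow (s := M) (t := N) H.Adj
  rw [sum_congr rfl h1, sum_const, smul_eq_mul] at h3
  have h4 := sum_le_card_nsmul N _ 2 h2
  rw [smul_eq_mul] at h4
  refine ⟨by omega, fun heq w hw v hv => ?_⟩
  have h5 : ∑ w ∈ N, (M.bipartiteBelow H.Adj w).card = ∑ w ∈ N, 2 := by
    rw [sum_const, smul_eq_mul]
    omega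
  have h6 := (sum_eq_sum_iff_of_le h2).1 h5 w hw
  have h7 : (↑(M.bipartiteBelow H.Adj w) : Set V) = H.neighborSet w :=
    Set.eq_of_subset_of_ncard_le (hsub w) (by rw [hH.2 w, Set.ncard_coe_finset, h6])
      (Set.finite_of_ncard_pos (by rw [hH.2 w]; norm_num))
  have h8 : v ∈ (↑(M.bipartiteBelow H.Adj w) : Set V) := h7 ▸ hv
  simp only [bipartiteBelow, coe_filter, Set.mem_ofPred_eq] at h8
  exact h8.1

theorem le_poly [Finite V] {G : SimpleGraph V} {𝓗 : Set G.Subgraph} (h𝓗 : 𝓗.Nonempty)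
    (hne : ∀ H ∈ 𝓗, H.edgeSet.Nonempty) {k : ℕ} (col : Sym2 V → ℕ) (hk : ∀ e, col e < k)
    (hcol : ∀ H ∈ 𝓗, ∀ j < k, ∃ e ∈ H.edgeSet, col e = j) : k ≤ poly G 𝓗 := by
  refine (isGreatest_poly G 𝓗 hne).2 ⟨fun e => ⟨col e, hk e⟩, ?_, ?_⟩
  · intro j
    obtain ⟨H, hH⟩ := h𝓗
    obtain ⟨e, he, hej⟩ := hcol H hH j j.2
    exact ⟨⟨e, H.edgeSet_subset he⟩, Fin.ext hej⟩
  · intro H hH j _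
    obtain ⟨e, he, hej⟩ := hcol H hH j j.2
    exact ⟨⟨e, H.edgeSet_subset he⟩, he, Fin.ext hej⟩

theorem poly_anti [Finite V] [Nonempty V] {G : SimpleGraph V} {𝓗 𝓚 : Set G.Subgraph} (h : 𝓗 ⊆ 𝓚)
    (hne : ∀ H ∈ 𝓚, H.edgeSet.Nonempty) : poly G 𝓚 ≤ poly G 𝓗 := by
  refine (isGreatest_poly G 𝓗 fun H hH => hne H (h hH)).2 ?_
  obtain ⟨φ, hφ, hp⟩ := (isGreatest_poly G 𝓚 hne).1
  exact ⟨φ, hφ, fun H hH => hp H (h hH)⟩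

theorem polyF2_le_polyHC {n : ℕ} (hn : 3 ≤ n) : polyF2 n ≤ polyHC n := by
  have : Nonempty (Fin n) := ⟨⟨0, by omega⟩⟩
  exact poly_anti (hamiltonianCycles_subset_twoFactors _)
    fun H hH => edgeSet_nonempty_of_mem_twoFactors hH

theorem two_pow_le_of_mem_colorCounts {n k : ℕ} (hn : 3 ≤ n)
    (h : k ∈ colorCounts (⊤ : SimpleGraph (Fin n)) (hamiltonianCycles ⊤)) : 2 ^ k ≤ 16 * n := by
  obtain ⟨φ, hφ, hp⟩ := h
  rcases Nat.eq_zero_or_pos k with hk | hk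
  · rw [hk]
    omega
  -- The default value reaches only diagonal pairs, which `avoid` ignores.
  let col : Sym2 (Fin n) → Fin k := Function.extend Subtype.val φ fun _ => ⟨0, hk⟩
  have hcol : ∀ e, col e.1 = φ e := fun e =>
    Subtype.val_injective.extend_apply φ _ e
  have hmain := two_pow_card_le_of_not_isHamiltonian (by rwa [Fintype.card_fin]) col ?_
  · rwa [Fintype.card_fin, Fintype.card_fin] at hmain
  intro t ht
  obtain ⟨a, p, hp'⟩ := ht (by rw [Fintype.card_fin]; omega)
  obtain ⟨e, he, het⟩ := hp _ ⟨a, p.map (.ofLE le_top), hp'.map Function.bijective_id, rfl⟩ t (hφ t)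
  rw [Walk.mem_edges_toSubgraph, Walk.edges_map] at he
  have he' : e.1 ∈ p.edges := by simpa using he
  have h2 := p.edges_subset_edgeSet he'
  rw [← hcol] at het
  revert h2 het
  generalize e.1 = x
  induction x with
  | h u v => exact fun het h2 => h2.2 het

theorem two_pow_polyHC_le {n : ℕ} (hn : 3 ≤ n) : 2 ^ polyHC n ≤ 16 * n := by
  have : Nonempty (Fin n) := ⟨⟨0, by omega⟩⟩
  exact two_pow_le_of_mem_colorCounts hn (isGreatest_poly _ _ fun H hH =>
    edgeSet_nonempty_of_mem_twoFactors (hamiltonianCycles_subset_twoFactors _ hH)).1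

/-- The coloring in which the color of an edge is determined by its smaller vertex and the function
`c`, with the exception of the edge `{0, 2}`, capped so that only colors below `k` are used. -/
def orderedColoring {n : ℕ} (c : ℕ → ℕ) (k : ℕ) (e : Sym2 (Fin n)) : ℕ :=
  min (if (e.inf : ℕ) = 0 ∧ (e.sup : ℕ) = 2 then 2 else c e.inf) (k - 1)

theorem orderedColoring_of_lt {n : ℕ} (c : ℕ → ℕ) (k : ℕ) {u v : Fin n} (h : u < v) :
    orderedColoring c k s(u, v) =
      min (if (u : ℕ) = 0 ∧ (v : ℕ) = 2 then 2 else c u) (k - 1) := by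
  simp only [orderedColoring, Sym2.inf_mk, Sym2.sup_mk, inf_eq_left.2 h.le, sup_eq_right.2 h.le]

/-- Recolouring `{0, 2}` makes the triangle on `0, 1, 2` cyclic: all edges at `j < 3` have colour
`j` except the one to `(j + 2) % 3`, and a 2-factor uses another edge at `j`. For later colours,
`hblock` provides an edge whose smaller end lies in the block. -/
theorem exists_orderedColoring_eq {n k : ℕ} (hn : 3 ≤ n) (hk : 3 ≤ k) {c p : ℕ → ℕ}
    (hp : ∀ i, 3 ≤ p i) (hc : ∀ v ≤ 2, c v = v)
    (hcp : ∀ i v, p i ≤ v → v < p (i + 1) → c v = 3 + i)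
    {H : (⊤ : SimpleGraph (Fin n)).Subgraph} (hH : H ∈ twoFactors ⊤)
    (hblock : ∀ i, 3 + i < k → ∃ v w : Fin n, H.Adj v w ∧ p i ≤ v ∧ v < p (i + 1) ∧ p i ≤ w)
    {j : ℕ} (hj : j < k) : ∃ e ∈ H.edgeSet, orderedColoring c k e = j := by
  rcases Nat.lt_or_ge j 3 with hj3 | hj3
  · have hz : (j + 2) % 3 < n := by omega
    obtain ⟨w, hwz, hw⟩ := exists_adj_of_mem_twoFactors hH ⟨j, by omega⟩ ⟨(j + 2) % 3, hz⟩
    refine ⟨s(⟨j, by omega⟩, w), hw, ?_⟩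
    have hne := hw.ne
    rw [Ne, Fin.ext_iff] at hwz hne
    simp only at hwz hne
    rcases lt_or_gt_of_ne hne with h | h
    · rw [orderedColoring_of_lt c k (show (⟨j, by omega⟩ : Fin n) < w from h), hc _ (by simp; omega)]
      split_ifs with h'
      · simp only at h'
        omega
      · simp only
        omega
    · rw [Sym2.eq_swap, orderedColoring_of_lt c k (show w < (⟨j, by omega⟩ : Fin n) from h),
        if_pos (by simp only; omega)]
      omega
  · obtain ⟨i, rfl⟩ := Nat.exists_eq_add_of_le hj3
    obtain ⟨v, w, hvw, h1, h2, h3⟩ := hblock i hj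
    have := hp i
    refine ⟨s(v, w), hvw, ?_⟩
    rcases lt_or_gt_of_ne hvw.ne with h | h
    · rw [orderedColoring_of_lt c k h, if_neg (by omega), hcp i v h1 h2]
      omega
    · have h' : (w : ℕ) < v := h
      rw [Sym2.eq_swap, orderedColoring_of_lt c k h, if_neg (by omega), hcp i w h3 (by omega)]
      omega

theorem orderedColoring_lt {n k : ℕ} (hk : 0 < k) (c : ℕ → ℕ) (e : Sym2 (Fin n)) :
    orderedColoring c k e < k := by
  unfold orderedColoring
  omega

theorem card_filter_val_lt {n a : ℕ} (ha : a ≤ n) :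
    (univ.filter fun v : Fin n => (v : ℕ) < a).card = a := by
  rw [Fin.card_filter_val_lt, min_eq_right ha]

theorem card_filter_le_val_lt {n a b : ℕ} (hab : a ≤ b) (hb : b ≤ n) :
    (univ.filter fun v : Fin n => a ≤ (v : ℕ) ∧ (v : ℕ) < b).card = b - a := by
  have h := card_filter_add_card_filter_not (s := univ.filter fun v : Fin n => (v : ℕ) < b)
    (fun v => (v : ℕ) < a)
  rw [filter_filter, filter_filter, card_filter_val_lt hb] at h
  have h1 : (univ.filter fun v : Fin n => (v : ℕ) < b ∧ (v : ℕ) < a).card = a := by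
    refine (congrArg card ?_).trans (card_filter_val_lt (hab.trans hb))
    ext v
    simp only [mem_filter, mem_univ, true_and]
    omega
  have h2 : (univ.filter fun v : Fin n => a ≤ (v : ℕ) ∧ (v : ℕ) < b) =
      univ.filter fun v : Fin n => (v : ℕ) < b ∧ ¬ (v : ℕ) < a := by
    ext v
    simp only [mem_filter, mem_univ, true_and]
    omega
  rw [h2]
  omega

theorem le_polyF2 {n k : ℕ} (hk : 3 ≤ k) (hn : 2 ^ k ≤ 2 * (n + 1)) : k ≤ polyF2 n := by
  have h8 : 2 ^ 3 ≤ 2 ^ k := Nat.pow_le_pow_right (by norm_num) hk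
  have hn3 : 3 ≤ n := by omega
  have : Nonempty (Fin n) := ⟨⟨0, by omega⟩⟩
  let c : ℕ → ℕ := fun v => if v ≤ 2 then v else Nat.log 2 (v + 1) + 1
  -- Block `i` has `2 ^ (i + 2)` vertices, one more than all earlier vertices together.
  let p : ℕ → ℕ := fun i => 2 ^ (i + 2) - 1
  have hp : ∀ i, 3 ≤ p i := fun i => by
    have : 2 ^ 2 ≤ 2 ^ (i + 2) := Nat.pow_le_pow_right (by norm_num) (by omega)
    simp only [p]
    omega
  refine le_poly ((nonempty_hamiltonianCycles_top (by rwa [Fintype.card_fin])).mono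
    (hamiltonianCycles_subset_twoFactors _)) (fun H hH => edgeSet_nonempty_of_mem_twoFactors hH)
    (orderedColoring c k) (orderedColoring_lt (by omega) c) fun H hH j hj =>
    exists_orderedColoring_eq hn3 hk (p := p) hp (fun v hv => if_pos hv) ?_ hH ?_ hj
  · intro i v h1 h2
    have := hp i
    refine (if_neg (by omega)).trans ?_
    rw [Nat.log_eq_of_pow_le_of_lt_pow (m := i + 2)]
    · omega
    · simp only [p] at h1
      omega
    · rw [show i + 2 + 1 = i + 1 + 2 by omega]
      simp only [p] at h2
      omega
  · intro i hi
    have h1 : 2 ^ (i + 4) ≤ 2 ^ k := Nat.pow_le_pow_right (by norm_num) (by omega)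
    have h2 : 2 ^ (i + 4) = 4 * 2 ^ (i + 2) := by ring
    have h3 : 2 ^ (i + 1 + 2) = 2 * 2 ^ (i + 2) := by ring
    have h4 : 0 < 2 ^ (i + 2) := by positivity
    by_contra! hcon
    have h5 := (card_le_card_of_mem_twoFactors hH
      (M := univ.filter fun v : Fin n => p i ≤ (v : ℕ) ∧ (v : ℕ) < p (i + 1))
      (N := univ.filter fun v : Fin n => (v : ℕ) < p i) fun v hv w hvw => by
        simp only [mem_filter, mem_univ, true_and] at hv ⊢
        exact hcon v w hvw hv.1 hv.2).1
    rw [card_filter_le_val_lt (by simp only [p]; omega) (by simp only [p]; omega),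
      card_filter_val_lt (by simp only [p]; omega)] at h5
    simp only [p] at h5
    omega

theorem le_polyHC {n k : ℕ} (hk : 3 ≤ k) (hn : 3 * 2 ^ k ≤ 8 * (n - 1)) : k ≤ polyHC n := by
  have h8 : 2 ^ 3 ≤ 2 ^ k := Nat.pow_le_pow_right (by norm_num) hk
  have hn3 : 3 ≤ n := by omega
  have : Nonempty (Fin n) := ⟨⟨0, by omega⟩⟩
  let c : ℕ → ℕ := fun v => if v ≤ 2 then v else Nat.log 2 (v / 3) + 3
  -- Block `i` has exactly as many vertices as precede it.
  let p : ℕ → ℕ := fun i => 3 * 2 ^ i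
  have hp : ∀ i, 3 ≤ p i := fun i => by
    have : 0 < 2 ^ i := by positivity
    simp only [p]
    omega
  refine le_poly (nonempty_hamiltonianCycles_top (by rwa [Fintype.card_fin]))
    (fun H hH => edgeSet_nonempty_of_mem_twoFactors (hamiltonianCycles_subset_twoFactors _ hH))
    (orderedColoring c k) (orderedColoring_lt (by omega) c) fun H hH j hj =>
    exists_orderedColoring_eq hn3 hk (p := p) hp (fun v hv => if_pos hv) ?_
      (hamiltonianCycles_subset_twoFactors _ hH) ?_ hj
  · intro i v h1 h2
    have := hp i
    refine (if_neg (by omega)).trans ?_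
    rw [Nat.log_eq_of_pow_le_of_lt_pow (m := i)]
    · omega
    · simp only [p] at h1
      omega
    · simp only [p] at h2
      omega
  · intro i hi
    have h1 : 2 ^ (i + 4) ≤ 2 ^ k := Nat.pow_le_pow_right (by norm_num) (by omega)
    have h2 : 2 ^ (i + 4) = 16 * 2 ^ i := by ring
    have h3 : p (i + 1) = 2 * p i := by simp only [p]; ring
    have h4 : p (i + 1) < n := by simp only [h3, p]; omega
    have h5 := hp i
    by_contra! hcon
    let M := univ.filter fun v : Fin n => p i ≤ (v : ℕ) ∧ (v : ℕ) < p (i + 1)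
    let N := univ.filter fun v : Fin n => (v : ℕ) < p i
    have hMN : ∀ v ∈ M, ∀ w, H.Adj v w → w ∈ N := fun v hv w hvw => by
      simp only [M, N, mem_filter, mem_univ, true_and] at hv ⊢
      exact hcon v w hvw hv.1 hv.2
    have hNM := (card_le_card_of_mem_twoFactors (hamiltonianCycles_subset_twoFactors _ hH) hMN).2
      (by
        simp only [M, N]
        rw [card_filter_le_val_lt (by omega) h4.le, card_filter_val_lt (by omega)]
        omega)
    -- Equality closes the first `p (i + 1)` vertices under adjacency in `H`, but the cycle must
    -- leave them since `p (i + 1) < n`.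
    obtain ⟨x, hx, y, hy, hxy⟩ := exists_adj_boundary hH {v | (v : ℕ) < p (i + 1)}
      (a := ⟨0, by omega⟩) (b := ⟨p (i + 1), h4⟩) (by simp only [Set.mem_ofPred_eq]; omega) (by simp)
    simp only [Set.mem_ofPred_eq] at hx hy
    rcases Nat.lt_or_ge x (p i) with h | h
    · have := hNM x (by simp [N, h]) y hxy
      simp only [M, mem_filter] at this
      omega
    · have := hMN x (by simp [M, h, hx]) y hxy
      simp only [N, mem_filter] at this
      omega

end Polychromatic

theorem theorem2 :
    ∃ c : ℕ, c ≤ 4 ∧ ∀ n : ℕ, 3 ≤ n →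
      (⌊Real.logb 2 (2 * ((n : ℝ) + 1))⌋ ≤ (Polychromatic.polyF2 n : ℤ) ∧
        Polychromatic.polyF2 n ≤ Polychromatic.polyHC n ∧
        (Polychromatic.polyHC n : ℤ) ≤ ⌊Real.logb 2 (n : ℝ)⌋ + (c : ℤ)) ∧
      ⌊Real.logb 2 (8 * ((n : ℝ) - 1) / 3)⌋ ≤ (Polychromatic.polyHC n : ℤ) := by
  refine ⟨4, le_rfl, fun n hn => ?_⟩
  have hn' : (3 : ℝ) ≤ n := by exact_mod_cast hn
  -- This settles both lower bounds when the floor is below 3, where the block construction does not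
  -- apply.
  have hF : 3 ≤ Polychromatic.polyF2 n := Polychromatic.le_polyF2 le_rfl (by omega)
  have hFH := Polychromatic.polyF2_le_polyHC hn
  have hfloor : ∀ {r : ℝ}, 1 ≤ r → ∃ k : ℕ, ⌊Real.logb 2 r⌋ = k ∧ (2 : ℝ) ^ k ≤ r := by
    intro r hr
    have h0 : 0 ≤ ⌊Real.logb 2 r⌋ :=
      Int.floor_nonneg.2 (Real.logb_nonneg (by norm_num) hr)
    obtain ⟨k, hk⟩ := Int.eq_ofNat_of_zero_le h0
    refine ⟨k, hk, ?_⟩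
    have h1 := Int.floor_le (Real.logb 2 r)
    rw [hk, Real.le_logb_iff_rpow_le (by norm_num) (by linarith)] at h1
    exact_mod_cast h1
  refine ⟨⟨?_, hFH, ?_⟩, ?_⟩
  · obtain ⟨k, hk, hk'⟩ := hfloor (show (1 : ℝ) ≤ 2 * ((n : ℝ) + 1) by linarith)
    rw [hk, Nat.cast_le]
    rcases Nat.lt_or_ge k 3 with h | h
    · omega
    · exact Polychromatic.le_polyF2 h (by exact_mod_cast hk')
  · have h1 := Polychromatic.two_pow_polyHC_le hn
    rw [← sub_le_iff_le_add, Int.le_floor, Real.le_logb_iff_rpow_le (by norm_num) (by linarith)]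
    push_cast
    rw [Real.rpow_sub (by norm_num), div_le_iff₀ (by positivity)]
    have h2 : (2 : ℝ) ^ Polychromatic.polyHC n ≤ 16 * n := by exact_mod_cast h1
    norm_num
    linarith
  · obtain ⟨k, hk, hk'⟩ := hfloor (show (1 : ℝ) ≤ 8 * ((n : ℝ) - 1) / 3 by linarith)
    rw [hk, Nat.cast_le]
    rcases Nat.lt_or_ge k 3 with h | h
    · omega
    · refine Polychromatic.le_polyHC h ?_
      rw [le_div_iff₀ (by norm_num)] at hk'
      have h2 : ((3 * 2 ^ k : ℕ) : ℝ) ≤ ((8 * (n - 1) : ℕ) : ℝ) := by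
        push_cast [Nat.cast_sub (show 1 ≤ n by omega)]
        linarith
      exact_mod_cast h2
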